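/- Write $\omega=\{0,1,2,\dots\}$, and give $2^\omega$ and $(2^\omega)^\omega$ their product topologies. A *perfect product* is a set $P\subseteq(2^\omega)^\omega$ such that $P=\prod_{k<\omega}P(k)$, where $P(k)=\{x(k):x\in P\}$, and each $P(k)$ is a perfect (nonempty, closed, without isolated points) subset of $2^\omega$. A Borel equivalence relation $\mathsf E$ on $(2^\omega)^\omega$ is *smooth* if there is a Borel map $f:(2^\omega)^\omega\to 2^\omega$ such that $x\mathrel{\mathsf E}y\iff f(x)=f(y)$ for all $x,y$. **Theorem.** Let $\mathsf E$ and $\mathsf F$ be smooth Borel equivalence relations on $(2^\omega)^\omega$. Then there is a perfect product $P$ such that at least one of the following holds: 1. $\mathsf F\subseteq\mathsf E$ on $P$, that is, for all $x,y\in P$, $x\mathrel{\mathsf F}y$ implies $x\mathrel{\mathsf E}y$; 2. for some $j<\omega$, both of the following hold: - $\mathsf E$ captures $j$ on $P$: for all $x,y\in P$, $x\mathrel{\mathsf E}y$ implies $x(j)=y(j)$; - $\mathsf F$ is reduced to $\omega\smallsetminus\{j\}$ on $P$: for all $x,y\in P$, if $x(k)=y(k)$ for all $k\ne j$, then $x\mathrel{\mathsf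 F}y$. -/

import Mathlib

/-- The Cantor space `2^ω`, with the product topology and its Borel structure. -/
abbrev Cantor : Type := ℕ → Bool

/-- The space `(2^ω)^ω`. -/
abbrev CantorSeq : Type := ℕ → Cantor

/-- The projection `P(k) = {x(k) : x ∈ P}` of a set `P ⊆ (2^ω)^ω` on the `k`-th coordinate. -/
def coordProj (P : Set CantorSeq) (k : ℕ) : Set Cantor :=
  {a | ∃ x ∈ P, x k = a}

/-- A perfect product: a set `P = ∏ₖ P(k)` all of whose projections `P(k)` are perfect, that is,
nonempty, closed and without isolated points (Mathlib's `Perfect` allows the empty set). -/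
def IsPerfectProduct (P : Set CantorSeq) : Prop :=
  P = {x | ∀ k, x k ∈ coordProj P k} ∧
    ∀ k, (coordProj P k).Nonempty ∧ Perfect (coordProj P k)

/-- `E` is a Borel subset of `(2^ω)^ω × (2^ω)^ω`. -/
def IsBorelEquivRel (E : Setoid CantorSeq) : Prop :=
  MeasurableSet {p : CantorSeq × CantorSeq | E p.1 p.2}

/-- `E` is smooth: some Borel map `f : (2^ω)^ω → 2^ω` satisfies `x E y ↔ f x = f y`. -/
def IsSmoothEquivRel (E : Setoid CantorSeq) : Prop :=
  ∃ f : CantorSeq → Cantor, Measurable f ∧ ∀ x y, E x y ↔ f x = f y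

/-- `F ⊆ E` on `P`. -/
def SubrelOn (F E : Setoid CantorSeq) (P : Set CantorSeq) : Prop :=
  ∀ x ∈ P, ∀ y ∈ P, F x y → E x y

/-- `E` captures `j` on `P`. -/
def CapturesOn (E : Setoid CantorSeq) (j : ℕ) (P : Set CantorSeq) : Prop :=
  ∀ x ∈ P, ∀ y ∈ P, E x y → x j = y j

/-- `E` is reduced to `U ⊆ ω` on `P`: points of `P` that agree on `U` are `E`-equivalent. -/
def ReducedOn (E : Setoid CantorSeq) (U : Set ℕ) (P : Set CantorSeq) : Prop :=
  ∀ x ∈ P, ∀ y ∈ P, Set.EqOn x y U → E x y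

/-! Perfect products are handled as ranges of coordinatewise embeddings, so shrinking is
composition. By Baire category (`exists_isCoordEmb_continuous_comp`), the maps `f` and `g` reducing
`E` and `F` may be taken continuous.

A fusion (`exists_fusion`) decides every pair of cells for `g`. If then `g x = g y` for points whose
cells differ in direction `j`, then `g` ignores `j` on the cell of `x`. Hence a continuous map
either ignores `j` on some subproduct or captures `j` on one (`exists_captures`).

Suppose alternative 2 fails on every subproduct. Wherever `g` can be made to ignore `n` inside a
cell of level `n`, so can `f` (`exists_cellDecided`). Given `g x = g y`, one walks from `x` towards
`y` one coordinate at a time, changing only coordinates that `f` ignores there; continuity of `f`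
yields `f x = f y` (`eq_of_decided`). -/

open Set Filter Topology

/-! ### Coordinate embeddings and cells -/

/-- A family of injective maps `φ k` of the Cantor space, each of which is nonexpanding: the first
`m` bits of `a` determine the first `m` bits of `φ k a`. -/
def IsCoordEmb (φ : ℕ → Cantor → Cantor) : Prop :=
  ∀ k, Function.Injective (φ k) ∧
    ∀ a b m, (∀ i < m, a i = b i) → ∀ i < m, φ k a i = φ k b i

/-- Each `φ k` preserves the first `n - k` bits. -/
def Fixes (n : ℕ) (φ : ℕ → Cantor → Cantor) : Prop :=
  ∀ k a i, i + k < n → φ k a i = a i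

/-- `x` and `y` lie in the same cell of level `n`: for each `k` the points `x k` and `y k` have the
same first `n - k` bits. -/
def SameCell (n : ℕ) (x y : CantorSeq) : Prop :=
  ∀ k i, i + k < n → x k i = y k i

/-- Coordinatewise composition. -/
def coordComp (φ ψ : ℕ → Cantor → Cantor) : ℕ → Cantor → Cantor :=
  fun k => φ k ∘ ψ k

theorem SameCell.refl (n : ℕ) (x : CantorSeq) : SameCell n x x := fun _ _ _ => rfl

theorem SameCell.symm {n : ℕ} {x y : CantorSeq} (h : SameCell n x y) : SameCell n y x :=
  fun k i hi => (h k i hi).symm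

theorem SameCell.trans {n : ℕ} {x y z : CantorSeq} (h : SameCell n x y) (h' : SameCell n y z) :
    SameCell n x z :=
  fun k i hi => (h k i hi).trans (h' k i hi)

theorem SameCell.mono {m n : ℕ} (hmn : m ≤ n) {x y : CantorSeq} (h : SameCell n x y) :
    SameCell m x y :=
  fun k i hi => h k i (hi.trans_le hmn)

theorem Fixes.sameCell {n : ℕ} {φ : ℕ → Cantor → Cantor} (h : Fixes n φ) (x : CantorSeq) :
    SameCell n x (Pi.map φ x) :=
  fun k i hi => (h k (x k) i hi).symm

theorem Fixes.mono {m n : ℕ} (hmn : m ≤ n) {φ : ℕ → Cantor → Cantor} (h : Fixes n φ) :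
    Fixes m φ :=
  fun k a i hi => h k a i (hi.trans_le hmn)

theorem fixes_id (n : ℕ) : Fixes n (fun _ => id) := fun _ _ _ _ => rfl

theorem Fixes.comp {n : ℕ} {φ ψ : ℕ → Cantor → Cantor} (h : Fixes n φ) (h' : Fixes n ψ) :
    Fixes n (coordComp φ ψ) :=
  fun k a i hi => (h k _ i hi).trans (h' k a i hi)

theorem isCoordEmb_id : IsCoordEmb (fun _ => id) :=
  fun _ => ⟨Function.injective_id, fun _ _ _ h => h⟩

theorem IsCoordEmb.comp {φ ψ : ℕ → Cantor → Cantor} (h : IsCoordEmb φ) (h' : IsCoordEmb ψ) :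
    IsCoordEmb (coordComp φ ψ) :=
  fun k => ⟨(h k).1.comp (h' k).1, fun a b m hab => (h k).2 _ _ m ((h' k).2 a b m hab)⟩

theorem eventually_prefix (a : Cantor) (m : ℕ) : ∀ᶠ b in 𝓝 a, ∀ i < m, b i = a i := by
  have : ∀ᶠ b : Cantor in 𝓝 a, ∀ j ∈ Finset.range m, b j = a j := by
    refine (Filter.eventually_all_finset _).2 fun j _ => ?_
    have hj : Continuous fun b : Cantor => b j := continuous_apply j
    exact hj.continuousAt.eventually (p := fun c => c = a j) (mem_nhds_discrete.2 rfl)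
  filter_upwards [this] with b hb i hi
  exact hb i (Finset.mem_range.2 hi)

theorem continuous_of_prefix {f : Cantor → Cantor}
    (h : ∀ a b m, (∀ i < m, a i = b i) → ∀ i < m, f a i = f b i) : Continuous f := by
  refine continuous_pi fun i => continuous_iff_continuousAt.2 fun a => ?_
  refine tendsto_nhds_of_eventually_eq ?_
  filter_upwards [eventually_prefix a (i + 1)] with b hb
  exact h b a (i + 1) hb i (Nat.lt_succ_self i)

theorem IsCoordEmb.continuous {φ : ℕ → Cantor → Cantor} (h : IsCoordEmb φ) :
    Continuous (Pi.map φ) :=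
  Continuous.piMap fun k => continuous_of_prefix (h k).2

theorem accPt_univ_cantor (a : Cantor) : AccPt a (𝓟 (univ : Set Cantor)) := by
  have hlim : Tendsto (fun n : ℕ => Function.update a n (!a n)) atTop (𝓝 a) := by
    refine tendsto_pi_nhds.2 fun i => tendsto_nhds_of_eventually_eq ?_
    filter_upwards [eventually_gt_atTop i] with n hn
    exact Function.update_of_ne hn.ne _ _
  refine accPt_iff_frequently.2
    (hlim.frequently (Frequently.of_forall fun n => ⟨fun h => ?_, trivial⟩))
  have := congrFun h n
  simp at this

theorem coordProj_range (φ : ℕ → Cantor → Cantor) (k : ℕ) :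
    coordProj (range (Pi.map φ)) k = range (φ k) := by
  ext a
  constructor
  · rintro ⟨_, ⟨x, rfl⟩, rfl⟩
    exact ⟨x k, rfl⟩
  · rintro ⟨b, rfl⟩
    exact ⟨_, ⟨fun _ => b, rfl⟩, rfl⟩

theorem IsCoordEmb.isPerfectProduct_range {φ : ℕ → Cantor → Cantor} (h : IsCoordEmb φ) :
    IsPerfectProduct (range (Pi.map φ)) := by
  have hc k : Continuous (φ k) := continuous_of_prefix (h k).2
  refine ⟨?_, fun k => ?_⟩
  · ext x
    simp only [coordProj_range, mem_ofPred_eq]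
    constructor
    · rintro ⟨y, rfl⟩ k
      exact ⟨y k, rfl⟩
    · intro hx
      choose y hy using hx
      exact ⟨y, funext hy⟩
  · rw [coordProj_range]
    refine ⟨range_nonempty _, (isCompact_range (hc k)).isClosed, ?_⟩
    rintro _ ⟨a, rfl⟩
    have := (accPt_univ_cantor a).map (hc k).continuousAt (h k).1
    rwa [map_principal, image_univ] at this

/-! ### Fusion -/

/-- `ψ n ∘ ψ (n + 1) ∘ ⋯ ∘ ψ (n + m - 1)`. -/
def compFrom (ψ : ℕ → ℕ → Cantor → Cantor) (n : ℕ) : ℕ → ℕ → Cantor → Cantor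
  | 0 => fun _ => id
  | m + 1 => coordComp (compFrom ψ n m) (ψ (n + m))

/-- The infinite composition `ψ n ∘ ψ (n + 1) ∘ ⋯`, for a sequence with `Fixes n (ψ n)`. -/
def fusion (ψ : ℕ → ℕ → Cantor → Cantor) (n : ℕ) : ℕ → Cantor → Cantor :=
  fun k a i => compFrom ψ n (i + k + 1) k a i

section Fusion

variable {ψ : ℕ → ℕ → Cantor → Cantor}

theorem compFrom_succ' (ψ : ℕ → ℕ → Cantor → Cantor) (n m : ℕ) :
    compFrom ψ n (m + 1) = coordComp (ψ n) (compFrom ψ (n + 1) m) := by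
  induction m with
  | zero => rfl
  | succ m ih =>
    rw [compFrom, ih, compFrom, show n + (m + 1) = n + 1 + m by ring]
    rfl

theorem isCoordEmb_compFrom (hψ : ∀ n, IsCoordEmb (ψ n)) (n m : ℕ) :
    IsCoordEmb (compFrom ψ n m) := by
  induction m with
  | zero => exact isCoordEmb_id
  | succ m ih => exact ih.comp (hψ _)

theorem fixes_compFrom (hfix : ∀ n, Fixes n (ψ n)) (n m : ℕ) : Fixes n (compFrom ψ n m) := by
  induction m with
  | zero => exact fixes_id n
  | succ m ih => exact ih.comp ((hfix _).mono (Nat.le_add_right n m))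

/-- Factors added beyond stage `i + k` fix bits `0, …, i` of coordinate `k`, and the nonexpanding
outer maps cannot see later bits. -/
theorem compFrom_eq_fusion (hψ : ∀ n, IsCoordEmb (ψ n)) (hfix : ∀ n, Fixes n (ψ n))
    (n k : ℕ) (a : Cantor) (i : ℕ) {m : ℕ} (hm : i + k < m) :
    compFrom ψ n m k a i = fusion ψ n k a i := by
  induction m, hm using Nat.le_induction with
  | base => rfl
  | succ m hm ih =>
    rw [← ih]
    refine (isCoordEmb_compFrom hψ n m k).2 _ _ (i + 1) (fun j hj => ?_) i (Nat.lt_succ_self i)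
    exact hfix (n + m) k a j (by omega)

theorem fixes_fusion (hfix : ∀ n, Fixes n (ψ n)) (n : ℕ) : Fixes n (fusion ψ n) :=
  fun k a i hi => fixes_compFrom hfix n _ k a i hi

theorem fusion_eq_comp (hψ : ∀ n, IsCoordEmb (ψ n)) (hfix : ∀ n, Fixes n (ψ n)) (n : ℕ) :
    fusion ψ n = coordComp (ψ n) (fusion ψ (n + 1)) := by
  funext k a i
  rw [← compFrom_eq_fusion hψ hfix n k a i (m := i + k + 1 + 1) (by omega), compFrom_succ']
  refine (hψ n k).2 _ _ (i + 1) (fun j hj => ?_) i (Nat.lt_succ_self i)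
  exact compFrom_eq_fusion hψ hfix (n + 1) k a j (by omega)

theorem fusion_zero_eq (hψ : ∀ n, IsCoordEmb (ψ n)) (hfix : ∀ n, Fixes n (ψ n)) (n : ℕ) :
    fusion ψ 0 = coordComp (compFrom ψ 0 n) (fusion ψ n) := by
  induction n with
  | zero => rfl
  | succ n ih =>
    rw [ih, fusion_eq_comp hψ hfix n, compFrom, zero_add]
    rfl

theorem isCoordEmb_fusion_zero (hψ : ∀ n, IsCoordEmb (ψ n)) (hfix : ∀ n, Fixes n (ψ n)) :
    IsCoordEmb (fusion ψ 0) := by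
  refine fun k => ⟨fun a b hab => funext fun i => ?_, fun a b m hab i hi => ?_⟩
  -- Split off enough factors that the remaining tail fixes bit `i` of coordinate `k`; the finite
  -- composition is injective.
  · rw [fusion_zero_eq hψ hfix (i + k + 1)] at hab
    have := congrFun ((isCoordEmb_compFrom hψ 0 (i + k + 1) k).1 hab) i
    rwa [fixes_fusion hfix _ k a i (Nat.lt_succ_self _),
      fixes_fusion hfix _ k b i (Nat.lt_succ_self _)] at this
  · exact (isCoordEmb_compFrom hψ 0 _ k).2 a b m hab i hi

theorem isCoordEmb_fusion (hψ : ∀ n, IsCoordEmb (ψ n)) (hfix : ∀ n, Fixes n (ψ n)) (n : ℕ) :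
    IsCoordEmb (fusion ψ n) := by
  refine fun k => ⟨?_, fun a b m hab i hi => ?_⟩
  · have := (isCoordEmb_fusion_zero hψ hfix k).1
    rw [fusion_zero_eq hψ hfix n] at this
    exact this.of_comp
  · exact (isCoordEmb_compFrom hψ n _ k).2 a b m hab i hi

end Fusion

/-- The class `C` is a parameter because the category argument also needs openness, which is
required at the finite stages only. -/
theorem exists_meeting_finite {ι : Type*} {C : (ℕ → Cantor → Cantor) → Prop}
    (hCid : C fun _ => id) (hCcomp : ∀ φ ψ, C φ → C ψ → C (coordComp φ ψ))
    (hCemb : ∀ φ, C φ → IsCoordEmb φ) (n : ℕ) (D : ι → (ℕ → Cantor → Cantor) → Prop)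
    (hD : ∀ i φ T, IsCoordEmb T → Fixes n T → D i φ → D i (coordComp φ T))
    {S : Set ι} (hS : S.Finite)
    (hmeet : ∀ i ∈ S, ∀ φ, C φ → ∃ ψ, C ψ ∧ Fixes n ψ ∧ D i (coordComp φ ψ))
    (φ : ℕ → Cantor → Cantor) (hφ : C φ) :
    ∃ ψ, C ψ ∧ Fixes n ψ ∧ ∀ i ∈ S, D i (coordComp φ ψ) := by
  induction S, hS using Set.Finite.induction_on with
  | empty => exact ⟨_, hCid, fixes_id n, fun i hi => hi.elim⟩
  | @insert i S _ _ ih =>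
    obtain ⟨ψ, hψ, hfix, hψD⟩ := ih fun j hj => hmeet j (mem_insert_of_mem i hj)
    obtain ⟨T, hT, hTfix, hTD⟩ := hmeet i (mem_insert i S) _ (hCcomp φ ψ hφ hψ)
    refine ⟨coordComp ψ T, hCcomp ψ T hψ hT, hfix.comp hTfix, fun j hj => ?_⟩
    rcases mem_insert_iff.1 hj with rfl | hj
    · exact hTD
    · exact hD j _ T (hCemb T hT) hTfix (hψD j hj)

/-- The fusion lemma: hereditary requirements, finitely many of them at each level, that can each be
met by a map preserving the cells of their level are all met by a single coordinate embedding. -/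
theorem exists_fusion {ι : Type*} {C : (ℕ → Cantor → Cantor) → Prop}
    (hCid : C fun _ => id) (hCcomp : ∀ φ ψ, C φ → C ψ → C (coordComp φ ψ))
    (hCemb : ∀ φ, C φ → IsCoordEmb φ) (D : ℕ → ι → (ℕ → Cantor → Cantor) → Prop)
    (hD : ∀ n i φ T, IsCoordEmb T → Fixes n T → D n i φ → D n i (coordComp φ T))
    (S : ℕ → Set ι) (hS : ∀ n, (S n).Finite)
    (hmeet : ∀ n, ∀ i ∈ S n, ∀ φ, C φ → ∃ ψ, C ψ ∧ Fixes n ψ ∧ D n i (coordComp φ ψ)) :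
    ∃ φ, IsCoordEmb φ ∧ ∀ n, ∀ i ∈ S n, D n i φ := by
  have key n (φ : {φ // C φ}) := exists_meeting_finite hCid hCcomp hCemb n (D n) (hD n) (hS n)
    (hmeet n) φ.1 φ.2
  choose next hnext hfix hnextD using key
  let Φ : ℕ → {φ // C φ} := fun n => Nat.rec ⟨_, hCid⟩
    (fun n φ => ⟨coordComp φ.1 (next n φ), hCcomp _ _ φ.2 (hnext n φ)⟩) n
  let ψ : ℕ → ℕ → Cantor → Cantor := fun n => next n (Φ n)
  have hψ n : IsCoordEmb (ψ n) := hCemb _ (hnext n _)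
  have hψfix n : Fixes n (ψ n) := hfix n _
  have hΦ n : compFrom ψ 0 n = (Φ n).1 := by
    induction n with
    | zero => rfl
    | succ n ih =>
      rw [compFrom, ih, zero_add]
  refine ⟨fusion ψ 0, isCoordEmb_fusion_zero hψ hψfix, fun n i hi => ?_⟩
  -- Requirements of level `n` hold at stage `n + 1`; the remaining tail preserves cells of level
  -- `n`, so heredity applies.
  rw [fusion_zero_eq hψ hψfix (n + 1), hΦ]
  exact hD n i _ _ (isCoordEmb_fusion hψ hψfix _)
    ((fixes_fusion hψfix (n + 1)).mono n.le_succ) (hnextD n _ i hi)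

theorem exists_finite_cells (n : ℕ) : ∃ S : Set CantorSeq, S.Finite ∧
    ∀ x, ∃ z ∈ S, SameCell n z x := by
  let rep : (Fin n → Fin n → Bool) → CantorSeq := fun v k i =>
    if h : k < n ∧ i < n then v ⟨k, h.1⟩ ⟨i, h.2⟩ else false
  refine ⟨range rep, finite_range rep, fun x => ⟨_, ⟨fun k i => x k i, rfl⟩, fun k i hi => ?_⟩⟩
  exact dif_pos (show k < n ∧ i < n by omega)

/-! ### Shrinking cells -/

/-- Replace the first `d` bits of `a` by the first `m` bits of `z`. -/
def spliceBits (d m : ℕ) (z a : Cantor) : Cantor :=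
  fun i => if i < m then z i else a (i - (m - d))

open Classical in
/-- Apply `t` to the points that share their first `d` bits with `z`, and keep the others. -/
noncomputable def graft (d : ℕ) (z : Cantor) (t : Cantor → Cantor) (a : Cantor) : Cantor :=
  if ∀ i < d, a i = z i then t a else a

theorem spliceBits_of_lt {d m i : ℕ} (z a : Cantor) (hi : i < m) : spliceBits d m z a i = z i :=
  if_pos hi

theorem spliceBits_prefix {d m : ℕ} (z : Cantor) (a b : Cantor) (l : ℕ)
    (h : ∀ i < l, a i = b i) (i : ℕ) (hi : i < l) :
    spliceBits d m z a i = spliceBits d m z b i := by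
  unfold spliceBits
  split_ifs
  · rfl
  · exact h _ (by omega)

/-- Splicing shifts the bits from `d` on and erases the first `d`, so agreement on the latter must
be assumed. -/
theorem spliceBits_inj {d m : ℕ} (hdm : d ≤ m) {z a b : Cantor} (hab : ∀ i < d, a i = b i)
    (h : spliceBits d m z a = spliceBits d m z b) : a = b := by
  funext i
  by_cases hi : i < d
  · exact hab i hi
  · have := congrFun h (i + (m - d))
    simp only [spliceBits, show ¬ i + (m - d) < m by omega, if_false, Nat.add_sub_cancel] at this
    exact this

theorem graft_of_mem {d : ℕ} {z a : Cantor} (t : Cantor → Cantor) (h : ∀ i < d, a i = z i) :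
    graft d z t a = t a :=
  if_pos h

theorem graft_fixes {d : ℕ} {z : Cantor} {t : Cantor → Cantor} (ht : ∀ a, ∀ i < d, t a i = z i)
    (a : Cantor) (i : ℕ) (hi : i < d) : graft d z t a i = a i := by
  unfold graft
  split_ifs with h
  · rw [ht a i hi, h i hi]
  · rfl

theorem graft_prefix {d : ℕ} {z : Cantor} {t : Cantor → Cantor}
    (ht : ∀ a, ∀ i < d, t a i = z i)
    (hp : ∀ a b m, (∀ i < m, a i = b i) → ∀ i < m, t a i = t b i) (a b : Cantor) (m : ℕ)
    (hab : ∀ i < m, a i = b i) (i : ℕ) (hi : i < m) : graft d z t a i = graft d z t b i := by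
  by_cases him : i < d
  · rw [graft_fixes ht a i him, graft_fixes ht b i him, hab i hi]
  · have hiff : (∀ j < d, a j = z j) ↔ ∀ j < d, b j = z j :=
      forall₂_congr fun j hj => by rw [hab j (by omega)]
    unfold graft
    by_cases h : ∀ j < d, a j = z j
    · rw [if_pos h, if_pos (hiff.1 h)]
      exact hp a b m hab i hi
    · rw [if_neg h, if_neg (mt hiff.2 h)]
      exact hab i hi

theorem graft_injective {d : ℕ} {z : Cantor} {t : Cantor → Cantor}
    (ht : ∀ a, ∀ i < d, t a i = z i)
    (hinj : ∀ a b, (∀ i < d, a i = z i) → (∀ i < d, b i = z i) → t a = t b → a = b) :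
    Function.Injective (graft d z t) := by
  intro a b hab
  have hiff : (∀ j < d, a j = z j) ↔ ∀ j < d, b j = z j :=
    forall₂_congr fun j hj => by rw [← graft_fixes ht a j hj, ← graft_fixes ht b j hj, hab]
  unfold graft at hab
  by_cases h : ∀ j < d, a j = z j
  · rw [if_pos h, if_pos (hiff.1 h)] at hab
    exact hinj a b h (hiff.1 h) hab
  · rwa [if_neg h, if_neg (mt hiff.2 h)] at hab

/-- The embedding of the whole space into the cell of level `n` of `z`. -/
def cellEmb (n : ℕ) (z : CantorSeq) : ℕ → Cantor → Cantor :=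
  fun k => spliceBits 0 n (z k)

theorem isCoordEmb_cellEmb (n : ℕ) (z : CantorSeq) : IsCoordEmb (cellEmb n z) :=
  fun k => ⟨fun _ _ h => spliceBits_inj (Nat.zero_le n) (by simp) h, spliceBits_prefix (z k)⟩

theorem sameCell_cellEmb (n : ℕ) (z x : CantorSeq) : SameCell n z (Pi.map (cellEmb n z) x) :=
  fun _ _ hi => (spliceBits_of_lt _ _ (by omega)).symm

/-- Apply `T` on the cell of level `n` of `z`. -/
noncomputable def cellGraft (n : ℕ) (z : CantorSeq) (T : ℕ → Cantor → Cantor) :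
    ℕ → Cantor → Cantor :=
  fun k => graft (n - k) (z k) (T k)

theorem cellGraft_apply {n : ℕ} {z x : CantorSeq} (T : ℕ → Cantor → Cantor)
    (h : SameCell n z x) : Pi.map (cellGraft n z T) x = Pi.map T x :=
  funext fun k => graft_of_mem _ fun i hi => (h k i (by omega)).symm

theorem bits_of_sameCell {n : ℕ} {z : CantorSeq} {T : ℕ → Cantor → Cantor}
    (h : ∀ x, SameCell n z (Pi.map T x)) (k : ℕ) (a : Cantor) (i : ℕ) (hi : i < n - k) :
    T k a i = z k i :=
  (h (fun _ => a) k i (by omega)).symm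

theorem fixes_cellGraft {n : ℕ} {z : CantorSeq} {T : ℕ → Cantor → Cantor}
    (h : ∀ x, SameCell n z (Pi.map T x)) : Fixes n (cellGraft n z T) :=
  fun k a i hi => graft_fixes (bits_of_sameCell h k) a i (by omega)

theorem isCoordEmb_cellGraft {n : ℕ} {z : CantorSeq} {T : ℕ → Cantor → Cantor}
    (hT : IsCoordEmb T) (h : ∀ x, SameCell n z (Pi.map T x)) : IsCoordEmb (cellGraft n z T) :=
  fun k => ⟨graft_injective (bits_of_sameCell h k) fun _ _ _ _ hab => (hT k).1 hab,
    graft_prefix (bits_of_sameCell h k) (hT k).2⟩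

/-- Shrink the cell of level `n` of `z` to the points that share with `z` the first `m` bits of the
first `m` coordinates. -/
noncomputable def push (n m : ℕ) (z : CantorSeq) : ℕ → Cantor → Cantor :=
  cellGraft n z fun k => spliceBits (n - k) (if k < m then m else 0) (z k)

theorem sameCell_splice {n m : ℕ} (hnm : n ≤ m) (z x : CantorSeq) :
    SameCell n z
      (Pi.map (fun k => spliceBits (n - k) (if k < m then m else 0) (z k)) x) := by
  intro k i hi
  refine (spliceBits_of_lt _ _ ?_).symm
  rw [if_pos (by omega)]
  omega

theorem fixes_push {n m : ℕ} (hnm : n ≤ m) (z : CantorSeq) : Fixes n (push n m z) :=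
  fixes_cellGraft (sameCell_splice hnm z)

theorem isCoordEmb_push {n m : ℕ} (hnm : n ≤ m) (z : CantorSeq) : IsCoordEmb (push n m z) := by
  refine fun k => ⟨graft_injective (bits_of_sameCell (sameCell_splice hnm z) k) ?_,
    graft_prefix (bits_of_sameCell (sameCell_splice hnm z) k) (spliceBits_prefix (z k))⟩
  refine fun a b ha hb hab => spliceBits_inj ?_ (fun i hi => (ha i hi).trans (hb i hi).symm) hab
  split_ifs <;> omega

theorem push_apply_of_sameCell {n m : ℕ} {z x : CantorSeq} (h : SameCell n z x) {k i : ℕ}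
    (hk : k < m) (hi : i < m) : Pi.map (push n m z) x k i = z k i := by
  rw [push, cellGraft_apply _ h]
  exact spliceBits_of_lt _ _ (by rwa [if_pos hk])

/-- On the cell, the continuous map `r` undoes the splice near its image; off the cell, the map is
locally the identity. -/
theorem isOpenMap_graft_spliceBits {d m : ℕ} (hdm : d ≤ m) (z : Cantor) :
    IsOpenMap (graft d z (spliceBits d m z)) := by
  have ht : ∀ a, ∀ i < d, spliceBits d m z a i = z i :=
    fun a i hi => spliceBits_of_lt _ _ (by omega)
  refine IsOpenMap.of_nhds_le fun a s hs => ?_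
  rw [mem_map] at hs
  by_cases h : ∀ i < d, a i = z i
  · rw [graft_of_mem _ h]
    let r : Cantor → Cantor := fun b i => if i < d then z i else b (i + (m - d))
    have hr : Continuous r := continuous_pi fun i => by
      by_cases hi : i < d
      · simpa [r, hi] using continuous_const
      · simpa [r, hi] using continuous_apply (i + (m - d))
    have hra : r (spliceBits d m z a) = a := by
      funext i
      by_cases hi : i < d
      · simp [r, hi, h i hi]
      · simp [r, hi, spliceBits, show ¬ i + (m - d) < m by omega]
    have hs' : ∀ᶠ b in 𝓝 (spliceBits d m z a), graft d z (spliceBits d m z) (r b) ∈ s := by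
      refine hr.continuousAt.eventually (p := fun c => graft d z (spliceBits d m z) c ∈ s) ?_
      rw [hra]
      exact hs
    filter_upwards [hs', eventually_prefix (spliceBits d m z a) m] with b hb hbm
    rw [graft_of_mem _ fun i hi => by simp [r, hi]] at hb
    convert hb using 1
    funext i
    by_cases hi : i < m
    · rw [spliceBits_of_lt _ _ hi, hbm i hi, spliceBits_of_lt _ _ hi]
    · simp only [spliceBits, hi, if_false, r, show ¬ i - (m - d) < d by omega]
      congr 1
      omega
  · have hga : graft d z (spliceBits d m z) a = a := if_neg h
    rw [hga]
    filter_upwards [hs, eventually_prefix a d] with b hb hbd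
    have hgb : graft d z (spliceBits d m z) b = b :=
      if_neg fun hb => h fun i hi => (hbd i hi).symm.trans (hb i hi)
    rwa [mem_preimage, hgb] at hb

theorem isOpenMap_push {n m : ℕ} (hnm : n ≤ m) (z : CantorSeq) :
    IsOpenMap (Pi.map (push n m z)) := by
  refine IsOpenMap.piMap (fun k => ?_) ?_
  · refine isOpenMap_graft_spliceBits ?_ (z k)
    split_ifs <;> omega
  -- A product of open maps is open if all but finitely many are surjective; here they are the
  -- identity from `m` on.
  · rw [Nat.cofinite_eq_atTop]
    filter_upwards [eventually_ge_atTop m] with k hk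
    have : push n m z k = id := by
      funext a
      simp [push, cellGraft, graft, spliceBits, funext_iff, Nat.not_lt.2 hk]
    rw [this]
    exact Function.surjective_id

/-! ### Baire category and reduction to continuous maps -/

theorem eventually_of_prefix {p : CantorSeq → Prop} {x : CantorSeq} (hp : ∀ᶠ y in 𝓝 x, p y) :
    ∃ m, ∀ m' ≥ m, ∀ y : CantorSeq, (∀ k < m', ∀ i < m', y k i = x k i) → p y := by
  by_contra! h
  choose m' hm' y hy hyp using h
  have hlim : Tendsto y atTop (𝓝 x) := by
    refine tendsto_pi_nhds.2 fun k => tendsto_pi_nhds.2 fun i =>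
      tendsto_nhds_of_eventually_eq ?_
    filter_upwards [eventually_gt_atTop k, eventually_gt_atTop i] with n hnk hni
    exact hy n k (hnk.trans_le (hm' n)) i (hni.trans_le (hm' n))
  obtain ⟨n, hn⟩ := (hlim.eventually hp).exists
  exact hyp n hn

theorem isOpen_sameCell (n : ℕ) (z : CantorSeq) : IsOpen {x | SameCell n z x} := by
  have : {x | SameCell n z x} =
      ⋂ k ∈ Iio n, ⋂ i ∈ Iio n, {x : CantorSeq | i + k < n → z k i = x k i} := by
    ext x
    simp only [SameCell, mem_ofPred_eq, mem_iInter, mem_Iio]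
    exact ⟨fun h k _ i _ => h k i, fun h k i hi => h k (by omega) i (by omega) hi⟩
  rw [this]
  refine (finite_Iio n).isOpen_biInter fun k _ => (finite_Iio n).isOpen_biInter fun i _ => ?_
  by_cases hi : i + k < n
  · simp only [hi, true_imp_iff]
    have hc : Continuous fun x : CantorSeq => x k i :=
      (continuous_apply i).comp (continuous_apply k)
    exact (isOpen_discrete {b | z k i = b}).preimage hc
  · simp [hi]

/-- A comeager set contains a perfect product. -/
theorem exists_isCoordEmb_mem_of_residual {G : Set CantorSeq} (hG : G ∈ residual CantorSeq) :
    ∃ φ, IsCoordEmb φ ∧ ∀ x, Pi.map φ x ∈ G := by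
  obtain ⟨t, htG, ht, htd⟩ := mem_residual.1 hG
  obtain ⟨O, hO, rfl⟩ := ht.eq_iInter_nat
  have hOd n : Dense (O n) := htd.mono (iInter_subset O n)
  choose S hS hScov using exists_finite_cells
  have hmeet : ∀ n, ∀ z ∈ S n, ∀ φ, IsCoordEmb φ ∧ IsOpenMap (Pi.map φ : CantorSeq → CantorSeq) →
      ∃ ψ, (IsCoordEmb ψ ∧ IsOpenMap (Pi.map ψ : CantorSeq → CantorSeq)) ∧ Fixes n ψ ∧
        ∀ x, SameCell n z x → Pi.map (coordComp φ ψ) x ∈ O n := by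
    rintro n z - φ ⟨hφ, hφo⟩
    -- Openness of `φ` makes the preimage of the dense set `O n` dense, so it meets the cell; the
    -- cell is then pushed close to `w`.
    obtain ⟨w, hzw, hw⟩ := ((hOd n).preimage hφo).inter_open_nonempty _ (isOpen_sameCell n z)
      ⟨z, SameCell.refl n z⟩
    obtain ⟨m, hm⟩ := eventually_of_prefix (((hO n).preimage hφ.continuous).mem_nhds hw)
    have hnm : n ≤ max n m := le_max_left n m
    refine ⟨push n (max n m) w, ⟨isCoordEmb_push hnm w, isOpenMap_push hnm w⟩,
      fixes_push hnm w, fun x hx => ?_⟩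
    exact hm _ (le_max_right n m) _ fun k hk i hi =>
      push_apply_of_sameCell (hzw.symm.trans hx) hk hi
  obtain ⟨φ, hφ, hφD⟩ := exists_fusion
    (C := fun φ => IsCoordEmb φ ∧ IsOpenMap (Pi.map φ : CantorSeq → CantorSeq))
    ⟨isCoordEmb_id, IsOpenMap.id⟩ (fun φ ψ hφ hψ => ⟨hφ.1.comp hψ.1, hφ.2.comp hψ.2⟩)
    (fun φ hφ => hφ.1) (fun n z φ => ∀ x, SameCell n z x → Pi.map φ x ∈ O n)
    (fun n z φ T _ hTn h x hx => h (Pi.map T x) (hx.trans (hTn.sameCell x))) S hS hmeet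
  refine ⟨φ, hφ, fun x => htG (mem_iInter.2 fun n => ?_)⟩
  obtain ⟨z, hz, hzx⟩ := hScov n x
  exact hφD n z hz x hzx

/-- Each set `f x i = b` is Borel, hence open modulo a meager set; countably many such sets are
corrected at once. -/
theorem exists_isCoordEmb_continuous_comp {f : CantorSeq → Cantor} (hf : Measurable f) :
    ∃ φ, IsCoordEmb φ ∧ Continuous fun x => f (Pi.map φ x) := by
  have hB (p : ℕ × Bool) : ∃ V : Set CantorSeq, IsOpen V ∧
      {x | f x p.1 = p.2} =ᵇ V := by
    have : MeasurableSet {x | f x p.1 = p.2} :=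
      (measurable_pi_apply p.1).comp hf (measurableSet_singleton p.2)
    exact this.residualEq_isOpen
  choose V hV hfV using hB
  have hres : {x | ∀ p : ℕ × Bool, f x p.1 = p.2 ↔ x ∈ V p} ∈ residual CantorSeq := by
    refine eventually_countable_forall.2 fun p => ?_
    filter_upwards [hfV p] with x hx
    exact iff_of_eq hx
  obtain ⟨φ, hφ, hmem⟩ := exists_isCoordEmb_mem_of_residual hres
  refine ⟨φ, hφ, continuous_pi fun i => continuous_discrete_rng.2 fun b => ?_⟩
  convert (hV (i, b)).preimage hφ.continuous using 1
  ext x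
  exact hmem x (i, b)

/-! ### The dichotomies -/

/-- Points that agree off `j` have the same value under `h`. -/
def ReducedOff (j : ℕ) (h : CantorSeq → Cantor) : Prop :=
  ∀ x y, (∀ k, k ≠ j → x k = y k) → h x = h y

/-- The value of `h` determines the coordinate `j`. -/
def Captures (j : ℕ) (h : CantorSeq → Cantor) : Prop :=
  ∀ x y, h x = h y → x j = y j

/-- Either `h` takes different values on the cells of level `n` of `x` and `y`, or it takes equal
values at any two points of these cells that agree on the coordinates where the cells agree. -/
def PairDecided (n : ℕ) (x y : CantorSeq) (h : CantorSeq → Cantor) : Prop :=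
  (∀ x' y', SameCell n x x' → SameCell n y y' → h x' ≠ h y') ∨
    ∀ x' y', SameCell n x x' → SameCell n y y' →
      (∀ k, (∀ i, i + k < n → x k i = y k i) → x' k = y' k) → h x' = h y'

theorem ReducedOff.comp {j : ℕ} {h : CantorSeq → Cantor} (hh : ReducedOff j h)
    (T : ℕ → Cantor → Cantor) : ReducedOff j (fun x => h (Pi.map T x)) :=
  fun _ _ hxy => hh _ _ fun k hk => congrArg (T k) (hxy k hk)

theorem PairDecided.comp {n : ℕ} {x y : CantorSeq} {h : CantorSeq → Cantor}
    (hd : PairDecided n x y h) {T : ℕ → Cantor → Cantor} (hT : Fixes n T) :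
    PairDecided n x y (fun x => h (Pi.map T x)) := by
  refine hd.imp (fun hd x' y' hx hy => ?_) fun hd x' y' hx hy hxy => ?_
  · exact hd _ _ (hx.trans (hT.sameCell x')) (hy.trans (hT.sameCell y'))
  · exact hd _ _ (hx.trans (hT.sameCell x')) (hy.trans (hT.sameCell y'))
      fun k hk => congrArg (T k) (hxy k hk)

theorem PairDecided.congr {n : ℕ} {x y z w : CantorSeq} {h : CantorSeq → Cantor}
    (hd : PairDecided n z w h) (hx : SameCell n z x) (hy : SameCell n w y) :
    PairDecided n x y h := by
  refine hd.imp (fun hd x' y' hx' hy' => hd _ _ (hx.trans hx') (hy.trans hy'))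
    fun hd x' y' hx' hy' hxy => hd _ _ (hx.trans hx') (hy.trans hy') fun k hk => hxy k ?_
  exact fun i hi => ((hx k i hi).symm.trans (hk i hi)).trans (hy k i hi)

/-- If equality fails at some `x'`, `y'`, continuity preserves a differing bit nearby, so both cells
are pushed towards these points. The targets are compatible because `x'` and `y'` agree in every
coordinate where the cells coincide. -/
theorem exists_pairDecided {h : CantorSeq → Cantor} (hh : Continuous h) (n : ℕ)
    (x y : CantorSeq) :
    ∃ ψ, IsCoordEmb ψ ∧ Fixes n ψ ∧ PairDecided n x y (fun x => h (Pi.map ψ x)) := by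
  by_cases hd : ∀ x' y', SameCell n x x' → SameCell n y y' →
      (∀ k, (∀ i, i + k < n → x k i = y k i) → x' k = y' k) → h x' = h y'
  · exact ⟨_, isCoordEmb_id, fixes_id n, Or.inr hd⟩
  push Not at hd
  obtain ⟨x', y', hx, hy, hxy, hne⟩ := hd
  obtain ⟨i, hi⟩ := Function.ne_iff.1 hne
  have hev z : ∀ᶠ z' in 𝓝 z, h z' i = h z i :=
    ((continuous_apply i).comp hh).continuousAt.eventually (p := fun c => c = h z i)
      (mem_nhds_discrete.2 rfl)
  obtain ⟨mx, hmx⟩ := eventually_of_prefix (hev x')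
  obtain ⟨my, hmy⟩ := eventually_of_prefix (hev y')
  let m := max n (max mx my)
  have hnm : n ≤ m := le_max_left _ _
  refine ⟨coordComp (push n m y') (push n m x'), (isCoordEmb_push hnm y').comp
    (isCoordEmb_push hnm x'), (fixes_push hnm y').comp (fixes_push hnm x'),
    Or.inl fun u v hu hv heq => hi ?_⟩
  have hu' : ∀ k < m, ∀ l < m, Pi.map (coordComp (push n m y') (push n m x')) u k l = x' k l := by
    intro k hk l hl
    have hux : Pi.map (push n m x') u k l = x' k l :=
      push_apply_of_sameCell (hx.symm.trans hu) hk hl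
    have hub : ∀ i < n - k, push n m x' k (u k) i = x' k i := fun i hi =>
      push_apply_of_sameCell (x := u) (hx.symm.trans hu) hk (by omega)
    change push n m y' k (push n m x' k (u k)) l = x' k l
    -- In a shared coordinate the second push has the same target `y' k = x' k`; elsewhere it is the
    -- identity on the cell of `x`.
    by_cases hk' : ∀ i, i + k < n → x k i = y k i
    · have hxyk := hxy k hk'
      rw [push, cellGraft, graft_of_mem _ fun i hi => by rw [hub i hi, hxyk],
        spliceBits_of_lt _ _ (by rwa [if_pos hk]), hxyk]
    · rw [push, cellGraft, graft, if_neg]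
      · exact hux
      · refine fun hall => hk' fun i hi => ?_
        rw [hx k i hi, hy k i hi, ← hall i (by omega), hub i (by omega)]
  have hv' : ∀ k < m, ∀ l < m, Pi.map (coordComp (push n m y') (push n m x')) v k l = y' k l := by
    intro k hk l hl
    exact push_apply_of_sameCell (x := Pi.map (push n m x') v)
      ((hy.symm.trans hv).trans ((fixes_push hnm x').sameCell v)) hk hl
  have h1 := hmx m ((le_max_left _ _).trans (le_max_right _ _)) _ hu'
  have h2 := hmy m ((le_max_right _ _).trans (le_max_right _ _)) _ hv'
  rw [← h1, ← h2]
  exact congrFun heq i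

/-- If `h` takes the same value at two points of different cells in direction `j`, and the pair of
cells is decided, then `h` does not depend on the coordinate `j` on the cell. -/
theorem PairDecided.reducedOff_cellEmb {n j : ℕ} {x y : CantorSeq} {h : CantorSeq → Cantor}
    (hd : PairDecided n x y h) (hxy : h x = h y) {i : ℕ} (hi : i + j < n)
    (hne : x j i ≠ y j i) : ReducedOff j (fun u => h (Pi.map (cellEmb n x) u)) := by
  classical
  rcases hd with hd | hd
  · exact absurd hxy (hd x y (SameCell.refl n x) (SameCell.refl n y))
  intro u v huv
  -- Since the cells differ in direction `j`, `w` does not involve `u j`; hence it serves as a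
  -- common partner for `u` and `v`.
  let w : CantorSeq := fun k =>
    if ∀ i, i + k < n → x k i = y k i then Pi.map (cellEmb n x) u k else y k
  have hw : SameCell n y w := by
    intro k l hl
    by_cases hk : ∀ i, i + k < n → x k i = y k i
    · simp only [w, if_pos hk]
      rw [← hk l hl]
      exact sameCell_cellEmb n x u k l hl
    · simp only [w, if_neg hk]
  have hu : h (Pi.map (cellEmb n x) u) = h w :=
    hd _ _ (sameCell_cellEmb n x u) hw fun k hk => (if_pos hk).symm
  have hv : h (Pi.map (cellEmb n x) v) = h w :=
    hd _ _ (sameCell_cellEmb n x v) hw fun k hk => by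
      have hkj : k ≠ j := by
        rintro rfl
        exact hne (hk i hi)
      rw [show w k = Pi.map (cellEmb n x) u k from if_pos hk]
      exact congrArg (cellEmb n x k) (huv k hkj).symm
  exact hu.trans hv.symm

/-- Once all pairs of cells are decided, equal values at points differing in coordinate `j` would
make `h` ignore `j` on a cell. -/
theorem exists_captures {h : CantorSeq → Cantor} (hh : Continuous h) (j : ℕ)
    (hnr : ∀ T, IsCoordEmb T → ¬ ReducedOff j (fun x => h (Pi.map T x))) :
    ∃ φ, IsCoordEmb φ ∧ Captures j (fun x => h (Pi.map φ x)) := by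
  choose S hS hScov using exists_finite_cells
  obtain ⟨φ, hφ, hφD⟩ := exists_fusion (C := IsCoordEmb) isCoordEmb_id
    (fun φ ψ hφ hψ => hφ.comp hψ) (fun φ hφ => hφ)
    (fun n (z : CantorSeq × CantorSeq) φ => PairDecided n z.1 z.2 fun x => h (Pi.map φ x))
    (fun n z φ T _ hTn hd => hd.comp hTn) (fun n => S n ×ˢ S n) (fun n => (hS n).prod (hS n))
    (fun n z _ φ hφ => exists_pairDecided (hh.comp hφ.continuous) n z.1 z.2)
  refine ⟨φ, hφ, fun x y hxy => ?_⟩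
  by_contra hne
  obtain ⟨i, hi⟩ := Function.ne_iff.1 hne
  obtain ⟨z, hz, hzx⟩ := hScov (i + j + 1) x
  obtain ⟨w, hw, hwy⟩ := hScov (i + j + 1) y
  exact hnr _ (hφ.comp (isCoordEmb_cellEmb (i + j + 1) x))
    (((hφD _ (z, w) ⟨hz, hw⟩).congr hzx hwy).reducedOff_cellEmb hxy (Nat.lt_succ_self _) hi)

/-! ### Comparing two continuous maps -/

/-- Either no subproduct of the cell of level `n` of `x` makes `g` independent of the coordinate
`n`, or `f` does not depend on this coordinate on the cell. -/
def CellDecided (n : ℕ) (x : CantorSeq) (f g : CantorSeq → Cantor) : Prop :=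
  (∀ T, IsCoordEmb T → (∀ u, SameCell n x (Pi.map T u)) →
      ¬ ReducedOff n (fun u => g (Pi.map T u))) ∨
    ∀ u v, SameCell n x u → SameCell n x v → (∀ k, k ≠ n → u k = v k) → f u = f v

theorem CellDecided.comp {n : ℕ} {x : CantorSeq} {f g : CantorSeq → Cantor}
    (hd : CellDecided n x f g) {T : ℕ → Cantor → Cantor} (hT : IsCoordEmb T) (hTn : Fixes n T) :
    CellDecided n x (fun u => f (Pi.map T u)) (fun u => g (Pi.map T u)) := by
  refine hd.imp (fun hd T' hT' hcell => ?_) fun hd u v hu hv huv => ?_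
  · exact hd _ (hT.comp hT') fun u => (hcell u).trans (hTn.sameCell _)
  · exact hd _ _ (hu.trans (hTn.sameCell u)) (hv.trans (hTn.sameCell v))
      fun k hk => congrArg (T k) (huv k hk)

theorem CellDecided.congr {n : ℕ} {x z : CantorSeq} {f g : CantorSeq → Cantor}
    (hd : CellDecided n z f g) (hx : SameCell n z x) : CellDecided n x f g :=
  hd.imp (fun hd T hT hcell => hd T hT fun u => hx.trans (hcell u))
    fun hd u v hu hv => hd u v (hx.trans hu) (hx.trans hv)

/-- If `g` ignores `n` on a subproduct of the cell, `f` cannot capture `n` on a smaller one, so by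
`exists_captures` it ignores `n` on one, which is grafted into the cell. -/
theorem exists_cellDecided {f g : CantorSeq → Cantor} (hf : Continuous f)
    (hfg : ∀ T j, IsCoordEmb T → Captures j (fun x => f (Pi.map T x)) →
      ¬ ReducedOff j (fun x => g (Pi.map T x))) (n : ℕ) (x : CantorSeq) :
    ∃ ψ, IsCoordEmb ψ ∧ Fixes n ψ ∧
      CellDecided n x (fun u => f (Pi.map ψ u)) (fun u => g (Pi.map ψ u)) := by
  by_cases hnr : ∀ T, IsCoordEmb T → (∀ u, SameCell n x (Pi.map T u)) →
      ¬ ReducedOff n (fun u => g (Pi.map T u))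
  · exact ⟨_, isCoordEmb_id, fixes_id n, Or.inl hnr⟩
  push Not at hnr
  obtain ⟨T, hT, hcell, hred⟩ := hnr
  by_cases hfr : ∃ T', IsCoordEmb T' ∧ ReducedOff n (fun u => f (Pi.map T (Pi.map T' u)))
  · obtain ⟨T', hT', hred'⟩ := hfr
    have hcell' : ∀ u, SameCell n x (Pi.map (coordComp T T') u) := fun u => hcell (Pi.map T' u)
    refine ⟨cellGraft n x (coordComp T T'), isCoordEmb_cellGraft (hT.comp hT') hcell',
      fixes_cellGraft hcell', Or.inr fun u v hu hv huv => ?_⟩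
    simp only [cellGraft_apply _ hu, cellGraft_apply _ hv]
    exact hred' u v huv
  · push Not at hfr
    obtain ⟨φ, hφ, hcap⟩ := exists_captures (hf.comp hT.continuous) n hfr
    exact absurd (hred.comp φ) (hfg _ n (hT.comp hφ) hcap)

/-- The combinatorial core: once all cells and pairs of cells are decided, `g x = g y` implies
`f x = f y`. -/
theorem eq_of_decided {f g : CantorSeq → Cantor} (hf : Continuous f)
    (hpair : ∀ n x y, PairDecided n x y g) (hcell : ∀ n x, CellDecided n x f g)
    {x y : CantorSeq} (hxy : g x = g y) : f x = f y := by
  classical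
  -- `v n` follows `x` where the level `n` cells coincide and `y` elsewhere, so it tends to `y`.
  let v : ℕ → CantorSeq := fun n k => if ∀ i, i + k < n → x k i = y k i then x k else y k
  have hlim : Tendsto v atTop (𝓝 y) := by
    refine tendsto_pi_nhds.2 fun k => tendsto_nhds_of_eventually_eq ?_
    by_cases hk : x k = y k
    · exact Eventually.of_forall fun n => by simp [v, hk]
    · obtain ⟨i, hi⟩ := Function.ne_iff.1 hk
      filter_upwards [eventually_gt_atTop (i + k)] with n hn
      exact if_neg fun h => hi (h i hn)
  have hstep (n j : ℕ) (u w : CantorSeq) (hu : ∀ k < j, u k = x k) (hw : ∀ k < j, w k = x k)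
      (huw : ∀ k, k ≠ j → u k = w k) (hj : ¬ ∀ i, i + j < n → x j i = y j i) : f u = f w := by
    push Not at hj
    obtain ⟨i, hi, hne⟩ := hj
    rcases hcell j x with hd | hd
    -- `g` ignores `j` on the level `n` cell of `x`, which lies in its level `j` cell because `j <
    -- n`.
    · refine absurd ((hpair n x y).reducedOff_cellEmb hxy hi hne)
        (hd _ (isCoordEmb_cellEmb n x) fun u => ?_)
      exact (sameCell_cellEmb n x u).mono (by omega)
    -- A cell of level `j` restricts only coordinates below `j`, where `u` and `w` equal `x`.
    · exact hd u w (fun k i hi => by rw [hu k (by omega)])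
        (fun k i hi => by rw [hw k (by omega)]) huw
  have hv (n : ℕ) : f x = f (v n) := by
    -- Interpolate from `w 0 = v n` to `w n = x`; coordinates from `n` on already agree, their cell
    -- condition being vacuous.
    let w : ℕ → CantorSeq := fun j k => if k < j then x k else v n k
    have hw (j : ℕ) : f (w j) = f (v n) := by
      induction j with
      | zero => simp [w]
      | succ j ih =>
        rw [← ih]
        have hoff : ∀ k, k ≠ j → w (j + 1) k = w j k := fun k hk => by
          simp only [w, show k < j + 1 ↔ k < j by omega]
        by_cases hj : ∀ i, i + j < n → x j i = y j i
        · congr 1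
          funext k
          by_cases hk : k = j
          · subst hk
            simp [w, v, if_pos hj]
          · exact hoff k hk
        · exact hstep n j _ _ (fun k hk => if_pos (by omega)) (fun k hk => if_pos hk) hoff hj
    rw [← hw n]
    congr 1
    funext k
    by_cases hk : k < n
    · simp [w, hk]
    · simp only [w, hk, if_false, v]
      exact (if_pos fun i hi => absurd hi (by omega)).symm
  have hlim' := (hf.tendsto y).comp hlim
  exact tendsto_nhds_unique (tendsto_const_nhds.congr hv) hlim'

theorem exists_forall_imp {f g : CantorSeq → Cantor} (hf : Continuous f) (hg : Continuous g)
    (hfg : ∀ T j, IsCoordEmb T → Captures j (fun x => f (Pi.map T x)) →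
      ¬ ReducedOff j (fun x => g (Pi.map T x))) :
    ∃ φ, IsCoordEmb φ ∧
      ∀ x y, g (Pi.map φ x) = g (Pi.map φ y) → f (Pi.map φ x) = f (Pi.map φ y) := by
  choose S hS hScov using exists_finite_cells
  have hmeet : ∀ n, ∀ z ∈ S n ×ˢ S n, ∀ φ, IsCoordEmb φ → ∃ ψ, IsCoordEmb ψ ∧ Fixes n ψ ∧
      (PairDecided n z.1 z.2 (fun x => g (Pi.map (coordComp φ ψ) x)) ∧
        CellDecided n z.1 (fun x => f (Pi.map (coordComp φ ψ) x))
          (fun x => g (Pi.map (coordComp φ ψ) x))) := by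
    intro n z _ φ hφ
    obtain ⟨ψ, hψ, hψn, hp⟩ := exists_pairDecided (hg.comp hφ.continuous) n z.1 z.2
    obtain ⟨T, hT, hTn, hd⟩ := exists_cellDecided
      (f := fun x => f (Pi.map (coordComp φ ψ) x)) (g := fun x => g (Pi.map (coordComp φ ψ) x))
      (hf.comp (hφ.comp hψ).continuous) (fun T j hT => hfg _ j ((hφ.comp hψ).comp hT)) n z.1
    exact ⟨coordComp ψ T, hψ.comp hT, hψn.comp hTn, hp.comp hTn, hd⟩
  obtain ⟨φ, hφ, hφD⟩ := exists_fusion (C := IsCoordEmb) isCoordEmb_id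
    (fun φ ψ hφ hψ => hφ.comp hψ) (fun φ hφ => hφ)
    (fun n (z : CantorSeq × CantorSeq) φ => PairDecided n z.1 z.2 (fun x => g (Pi.map φ x)) ∧
      CellDecided n z.1 (fun x => f (Pi.map φ x)) (fun x => g (Pi.map φ x)))
    (fun n z φ T hT hTn hd => ⟨hd.1.comp hTn, hd.2.comp hT hTn⟩)
    (fun n => S n ×ˢ S n) (fun n => (hS n).prod (hS n)) hmeet
  refine ⟨φ, hφ, fun x y hxy => ?_⟩
  refine eq_of_decided (f := fun x => f (Pi.map φ x)) (g := fun x => g (Pi.map φ x))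
    (hf.comp hφ.continuous) (fun n x y => ?_) (fun n x => ?_) hxy
  · obtain ⟨z, hz, hzx⟩ := hScov n x
    obtain ⟨w, hw, hwy⟩ := hScov n y
    exact (hφD n (z, w) ⟨hz, hw⟩).1.congr hzx hwy
  · obtain ⟨z, hz, hzx⟩ := hScov n x
    exact (hφD n (z, z) ⟨hz, hz⟩).2.congr hzx

theorem theorem1 (E F : Setoid CantorSeq)
    (hEB : IsBorelEquivRel E) (hE : IsSmoothEquivRel E)
    (hFB : IsBorelEquivRel F) (hF : IsSmoothEquivRel F) :
    ∃ P : Set CantorSeq, IsPerfectProduct P ∧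
      (SubrelOn F E P ∨ ∃ j : ℕ, CapturesOn E j P ∧ ReducedOn F {j}ᶜ P) := by
  obtain ⟨f, hf, hfE⟩ := hE
  obtain ⟨g, hg, hgF⟩ := hF
  obtain ⟨α, hα, hfα⟩ := exists_isCoordEmb_continuous_comp hf
  -- `β` is chosen for `g` after `α`; being continuous, it keeps `f` continuous.
  obtain ⟨β, hβ, hgβ⟩ :=
    exists_isCoordEmb_continuous_comp (hg.comp hα.continuous.measurable)
  have hγ := hα.comp hβ
  by_cases hfg : ∃ T j, IsCoordEmb T ∧
      Captures j (fun x => f (Pi.map (coordComp α β) (Pi.map T x))) ∧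
        ReducedOff j (fun x => g (Pi.map (coordComp α β) (Pi.map T x)))
  · obtain ⟨T, j, hT, hcap, hred⟩ := hfg
    have hP := hγ.comp hT
    refine ⟨_, hP.isPerfectProduct_range, Or.inr ⟨j, ?_, ?_⟩⟩
    · rintro _ ⟨x, rfl⟩ _ ⟨y, rfl⟩ hxy
      exact congrArg (coordComp (coordComp α β) T j) (hcap x y ((hfE _ _).1 hxy))
    · rintro _ ⟨x, rfl⟩ _ ⟨y, rfl⟩ hxy
      -- Agreement in the product pulls back to the parameters by injectivity.
      exact (hgF _ _).2 (hred x y fun k hk => (hP k).1 (hxy hk))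
  · push Not at hfg
    obtain ⟨φ, hφ, himp⟩ := exists_forall_imp (hfα.comp hβ.continuous) hgβ hfg
    refine ⟨_, (hγ.comp hφ).isPerfectProduct_range, Or.inl ?_⟩
    rintro _ ⟨x, rfl⟩ _ ⟨y, rfl⟩ hxy
    exact (hfE _ _).2 (himp x y ((hgF _ _).1 hxy))
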